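/- Let $n\ge 1$. There exists a finite constant $C_n$, depending only on $n$, such that for every locally finite (positive) Borel measure $\mu$ on $\mathbb R^n$ and every compactly supported Lipschitz function $u:\mathbb R^n\to\mathbb R$, $$\int_{\mathbb R^n}|u|\,d\mu\le C_n\int_{\mathbb R^n}|\nabla u(x)|\,M_1\mu(x)\,dx,$$ where $$M_1\mu(x)=\sup_{r>0}\, r\,\frac{\mu(B_r(x))}{|B_r(x)|}\in[0,\infty]$$ is the fractional maximal function of order $1$, $B_r(x)$ is the open Euclidean ball of radius $r$ centred at $x$, and $|\cdot|$ and $dx$ denote Lebesgue measure. Here $\nabla u$ is the almost everywhere defined gradient of $u$, both integrals take values in $[0,\infty]$, and $0\cdot\infty=0$. -/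

import Mathlib

open MeasureTheory
open scoped NNReal ENNReal

/-- The (centred) fractional maximal function of order `α` of a measure `μ` on `ℝⁿ`:
`M_α μ (x) = sup_{r > 0} r ^ α * (μ (B_r(x)) / |B_r(x)|)`, with values in `[0, ∞]`.
Here `B_r(x)` is the open Euclidean ball and `|·|` is Lebesgue measure. -/
noncomputable def fractionalMaximal {n : ℕ} (α : ℝ) (μ : Measure (EuclideanSpace ℝ (Fin n)))
    (x : EuclideanSpace ℝ (Fin n)) : ℝ≥0∞ :=
  ⨆ (r : ℝ) (_ : 0 < r),
    ENNReal.ofReal (r ^ α) * (μ (Metric.ball x r) / volume (Metric.ball x r))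

/-! ### Poincaré-type double average on balls. -/

section Poincare

variable {E : Type*} [NormedAddCommGroup E] [NormedSpace ℝ E]

/-! The proof is a discrete version of "coarea formula plus boxing inequality", with slices `a < |u|
< a + h` in place of level-set perimeters. Fix `h` and a point with `|u| ≥ a + h`. In the ball of
radius `R` around it, `{a < |u|}` fills at most half the volume; once `K R / 2 ^ N < h` it fills the
ball of radius `R / 2 ^ N`. Some intermediate dyadic ball `B` of radius `r` is therefore balanced
between `{|u| ≤ a}` and `{a < |u|}` (`LipschitzWith.exists_ball_balanced`).

If the slice is thin in `B`, the Poincaré estimate for the truncation of `|u|` to the slice gives `h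
|B| ≤ C r ∫ |∇u|` over the slice in `B`. Since `r μ(6B) ≤ 7 ^ n |B| M₁μ` on `B`, a Vitali covering
bounds `h μ` of such points by the integral of `|∇u| M₁μ` over the slice
(`mul_measure_le_lintegral_mul_fractionalMaximal`).

The remaining points are crowded by the slice at one of `N` scales. Slices at different levels `a =
i h` are disjoint, so the total `μ`-mass of crowded points, summed over levels, is at most `N 2 ^ (n
+ 2) μ(supp u)` (`tsum_measure_inter_crowdedPoints_le`). Summing the levels leaves an error of order
`h N`; as `N` grows only like `log (1 / h)`, it vanishes as `h → 0`. -/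

theorem LipschitzWith.enorm_sub_le_lintegral_fderiv_lineMap {K : ℝ≥0} {v : E → ℝ}
    (hv : LipschitzWith K v) {y z : E}
    (hd : ∀ᵐ s : ℝ, DifferentiableAt ℝ v (AffineMap.lineMap y z s)) :
    ‖v z - v y‖ₑ ≤ ∫⁻ s in Set.Ioc (0 : ℝ) 1,
      ‖fderiv ℝ v (AffineMap.lineMap y z s)‖ₑ * ‖z - y‖ₑ := by
  set f : ℝ → ℝ := fun s => v (AffineMap.lineMap y z s) with hf
  have hline : LipschitzWith (nndist y z) (AffineMap.lineMap y z : ℝ → E) := lipschitzWith_lineMap y z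
  have hfl : LipschitzWith (K * nndist y z) f := hv.comp hline
  have hac : AbsolutelyContinuousOnInterval f 0 1 :=
    hfl.lipschitzOnWith.absolutelyContinuousOnInterval
  have hftc := hac.integral_deriv_eq_sub
  have h1 : v z - v y = ∫ s in Set.Ioc (0 : ℝ) 1, deriv f s := by
    rw [← intervalIntegral.integral_of_le zero_le_one, hftc]
    simp [hf]
  rw [h1]
  refine (enorm_integral_le_lintegral_enorm _).trans (lintegral_mono_ae ?_)
  refine ae_restrict_of_ae ?_
  filter_upwards [hd] with s hs
  have hder : HasDerivAt f (fderiv ℝ v (AffineMap.lineMap y z s) (z - y)) s := by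
    have hl : HasDerivAt (AffineMap.lineMap y z : ℝ → E) (z - y) s :=
      AffineMap.hasDerivAt_lineMap
    exact hs.hasFDerivAt.comp_hasDerivAt s hl
  rw [hder.deriv]
  exact ContinuousLinearMap.le_opENorm _ _

variable [FiniteDimensional ℝ E] [MeasurableSpace E] [BorelSpace E]
  (ν : Measure E) [ν.IsAddHaarMeasure]

theorem MeasureTheory.Measure.map_addHaar_lineMap (y : E) {s : ℝ} (hs : s ≠ 0) :
    ν.map (fun z => AffineMap.lineMap y z s) =
      ENNReal.ofReal |(s ^ Module.finrank ℝ E)⁻¹| • ν := by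
  have h : (fun z => AffineMap.lineMap y z s) = (fun w => w + (1 - s) • y) ∘ (fun z : E => s • z) := by
    funext z
    simp [AffineMap.lineMap_apply_module, add_comm]
  rw [h, ← Measure.map_map (by fun_prop) (by fun_prop), Measure.map_addHaar_smul ν hs,
    Measure.map_smul, map_add_right_eq_self]

/-- Rademacher's null set could contain a given segment. For fixed `s ≠ 0`, however, `z ↦ lineMap y
z s` is a dilation about `y` and pulls null sets back to null sets; Fubini then exchanges `s` and
`z`. -/
theorem LipschitzWith.ae_ae_differentiableAt_lineMap {K : ℝ≥0} {v : E → ℝ}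
    (hv : LipschitzWith K v) (y : E) :
    ∀ᵐ z ∂ν, ∀ᵐ s : ℝ, DifferentiableAt ℝ v (AffineMap.lineMap y z s) := by
  have hms : MeasurableSet {x | DifferentiableAt ℝ v x} := measurableSet_of_differentiableAt ℝ v
  have hcont : Continuous fun p : E × ℝ => (AffineMap.lineMap y p.1 p.2 : E) := by
    simp only [AffineMap.lineMap_apply_module]; fun_prop
  rw [Measure.ae_ae_comm (p := fun z s => DifferentiableAt ℝ v (AffineMap.lineMap y z s))
    (hcont.measurable hms)]
  have h0 : ∀ᵐ s : ℝ, s ≠ 0 := by simp [ae_iff]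
  filter_upwards [h0] with s hs
  have hmap := Measure.map_addHaar_lineMap ν y hs
  have hc : Continuous fun z : E => (AffineMap.lineMap y z s : E) := by
    simp only [AffineMap.lineMap_apply_module]; fun_prop
  have : ∀ᵐ x ∂(ν.map fun z => (AffineMap.lineMap y z s : E)), DifferentiableAt ℝ v x := by
    rw [hmap]
    exact Measure.ae_smul_measure hv.ae_differentiableAt _
  exact ae_of_ae_map hc.measurable.aemeasurable this

/-- Contraction towards `y` by the factor `s` keeps the convex set inside itself, and its inverse
Jacobian `s⁻ᵈ` is at most `2ᵈ`. -/
theorem setLIntegral_comp_lineMap_le {B : Set E} (hB : Convex ℝ B) (hBm : MeasurableSet B)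
    {g : E → ℝ≥0∞} (hg : Measurable g) {y : E} (hy : y ∈ B) {s : ℝ} (hs : 1 / 2 ≤ s) (hs1 : s ≤ 1) :
    ∫⁻ z in B, g (AffineMap.lineMap y z s) ∂ν ≤ 2 ^ Module.finrank ℝ E * ∫⁻ z in B, g z ∂ν := by
  have hc : Continuous fun z : E => (AffineMap.lineMap y z s : E) := by
    simp only [AffineMap.lineMap_apply_module]; fun_prop
  calc ∫⁻ z in B, g (AffineMap.lineMap y z s) ∂ν
      ≤ ∫⁻ z, B.indicator g (AffineMap.lineMap y z s) ∂ν := by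
        rw [← lintegral_indicator hBm]
        refine lintegral_mono fun z => ?_
        by_cases hz : z ∈ B
        · have : (AffineMap.lineMap y z s : E) ∈ B :=
            hB.lineMap_mem hy hz ⟨by linarith, hs1⟩
          simp [hz, this]
        · simp [hz]
    _ = ∫⁻ w, B.indicator g w ∂(ν.map fun z => (AffineMap.lineMap y z s : E)) :=
        (lintegral_map (hg.indicator hBm) hc.measurable).symm
    _ = ENNReal.ofReal |(s ^ Module.finrank ℝ E)⁻¹| * ∫⁻ z in B, g z ∂ν := by
        rw [Measure.map_addHaar_lineMap ν y (by linarith), lintegral_smul_measure,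
          lintegral_indicator hBm, smul_eq_mul]
    _ ≤ _ := by
        gcongr
        have hs0 : 0 < s := by linarith
        rw [abs_of_pos (by positivity), ← inv_pow, ENNReal.ofReal_pow (by positivity)]
        gcongr
        rw [show (2 : ℝ≥0∞) = ENNReal.ofReal 2 by simp]
        apply ENNReal.ofReal_le_ofReal
        rw [inv_le_comm₀ hs0 (by norm_num)]
        linarith

/-- The double average of `|v y - v z|` over a ball is controlled by the integral of the
derivative. -/
theorem LipschitzWith.lintegral_lintegral_enorm_sub_le {K : ℝ≥0} {v : E → ℝ}
    (hv : LipschitzWith K v) (x : E) {r : ℝ} :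
    ∫⁻ y in Metric.ball x r, ∫⁻ z in Metric.ball x r, ‖v z - v y‖ₑ ∂ν ∂ν ≤
      2 ^ Module.finrank ℝ E * ENNReal.ofReal (2 * r) * ν (Metric.ball x r) *
        ∫⁻ z in Metric.ball x r, ‖fderiv ℝ v z‖ₑ ∂ν := by
  set B := Metric.ball x r with hBdef
  have hBm : MeasurableSet B := measurableSet_ball
  have hB : Convex ℝ B := convex_ball x r
  set g : E → ℝ≥0∞ := fun z => ‖fderiv ℝ v z‖ₑ with hgdef
  have hg : Measurable g := (measurable_fderiv ℝ v).enorm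
  have hgl : Measurable fun p : (E × E) × ℝ => g (AffineMap.lineMap p.1.1 p.1.2 p.2) := by
    refine hg.comp (Continuous.measurable ?_)
    simp only [AffineMap.lineMap_apply_module]; fun_prop
  have hI : ∀ s ∈ Set.Ioc (0 : ℝ) 1, ∫⁻ y in B, ∫⁻ z in B, g (AffineMap.lineMap y z s) ∂ν ∂ν ≤
      2 ^ Module.finrank ℝ E * ν B * ∫⁻ z in B, g z ∂ν := by
    have key : ∀ s : ℝ, 1 / 2 ≤ s → s ≤ 1 →
        ∫⁻ y in B, ∫⁻ z in B, g (AffineMap.lineMap y z s) ∂ν ∂ν ≤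
          2 ^ Module.finrank ℝ E * ν B * ∫⁻ z in B, g z ∂ν := by
      intro s hs hs1
      calc _ ≤ ∫⁻ y in B, 2 ^ Module.finrank ℝ E * ∫⁻ z in B, g z ∂ν ∂ν :=
            setLIntegral_mono' hBm fun y hy => setLIntegral_comp_lineMap_le ν hB hBm hg hy hs hs1
        _ = _ := by rw [setLIntegral_const]; ring
    intro s hs
    -- For small `s` the Jacobian degenerates in `z`; exchanging `y` and `z` replaces `s` by `1 - s
    -- ≥ 1 / 2`.
    rcases le_total (1 / 2) s with h | h
    · exact key s h hs.2
    · rw [lintegral_lintegral_swap]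
      · have := key (1 - s) (by linarith) (by linarith [hs.1])
        simpa only [AffineMap.lineMap_apply_one_sub] using this
      · exact (hgl.comp (measurable_id.prodMk measurable_const)).aemeasurable
  calc ∫⁻ y in B, ∫⁻ z in B, ‖v z - v y‖ₑ ∂ν ∂ν
      ≤ ∫⁻ y in B, ∫⁻ z in B, ENNReal.ofReal (2 * r) * ∫⁻ s in Set.Ioc (0 : ℝ) 1,
          g (AffineMap.lineMap y z s) ∂volume ∂ν ∂ν := by
        refine setLIntegral_mono' hBm fun y hy => lintegral_mono_ae ?_
        filter_upwards [ae_restrict_of_ae (hv.ae_ae_differentiableAt_lineMap ν y),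
          ae_restrict_mem hBm] with z hz hzB
        refine (hv.enorm_sub_le_lintegral_fderiv_lineMap hz).trans ?_
        rw [lintegral_mul_const' _ _ enorm_ne_top, mul_comm]
        gcongr
        rw [← ofReal_norm, ← dist_eq_norm]
        apply ENNReal.ofReal_le_ofReal
        have h1 := Metric.mem_ball.1 hzB
        have h2 := Metric.mem_ball.1 hy
        linarith [dist_triangle_right z y x]
    _ = ENNReal.ofReal (2 * r) * ∫⁻ s in Set.Ioc (0 : ℝ) 1, ∫⁻ y in B, ∫⁻ z in B,
          g (AffineMap.lineMap y z s) ∂ν ∂ν ∂volume := by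
        simp_rw [lintegral_const_mul' (ENNReal.ofReal (2 * r)) _ ENNReal.ofReal_ne_top]
        congr 1
        have h1 : ∀ y, ∫⁻ z in B, ∫⁻ s in Set.Ioc (0 : ℝ) 1, g (AffineMap.lineMap y z s) ∂volume ∂ν =
            ∫⁻ s in Set.Ioc (0 : ℝ) 1, ∫⁻ z in B, g (AffineMap.lineMap y z s) ∂ν ∂volume := by
          intro y
          rw [lintegral_lintegral_swap]
          exact (hgl.comp (((measurable_const.prodMk measurable_fst).prodMk
            measurable_snd))).aemeasurable
        simp_rw [h1]
        rw [lintegral_lintegral_swap]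
        have h2 : Measurable fun q : (E × ℝ) × E => g (AffineMap.lineMap q.1.1 q.2 q.1.2) := by
          refine hg.comp (Continuous.measurable ?_)
          simp only [AffineMap.lineMap_apply_module]; fun_prop
        have h3 : Measurable fun q : E × ℝ =>
            ∫⁻ z in B, g (AffineMap.lineMap q.1 z q.2) ∂ν := h2.lintegral_prod_right'
        exact h3.aemeasurable
    _ ≤ ENNReal.ofReal (2 * r) * ∫⁻ s in Set.Ioc (0 : ℝ) 1,
          2 ^ Module.finrank ℝ E * ν B * ∫⁻ z in B, g z ∂ν := by
        exact mul_le_mul' le_rfl (setLIntegral_mono' measurableSet_Ioc hI)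
    _ = _ := by
        rw [setLIntegral_const]
        simp
        ring

end Poincare

/-! ### Truncation to a slice and relative isoperimetry. -/

section Slice

/-- The normalised truncation of `|u|` between the levels `a` and `a + h`. -/
noncomputable def levelSlice {E : Type*} (u : E → ℝ) (a h : ℝ) (x : E) : ℝ :=
  max 0 (min 1 ((|u x| - a) / h))

theorem levelSlice_nonneg {E : Type*} (u : E → ℝ) (a h : ℝ) (x : E) : 0 ≤ levelSlice u a h x :=
  le_max_left _ _

theorem levelSlice_le_one {E : Type*} (u : E → ℝ) (a h : ℝ) (x : E) : levelSlice u a h x ≤ 1 :=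
  max_le zero_le_one (min_le_left _ _)

theorem levelSlice_eq_zero {E : Type*} {u : E → ℝ} {a h : ℝ} (hh : 0 < h) {x : E}
    (hx : |u x| ≤ a) : levelSlice u a h x = 0 :=
  max_eq_left ((min_le_right _ _).trans (div_nonpos_of_nonpos_of_nonneg (by linarith) hh.le))

theorem levelSlice_eq_one {E : Type*} {u : E → ℝ} {a h : ℝ} (hh : 0 < h) {x : E}
    (hx : a + h ≤ |u x|) : levelSlice u a h x = 1 := by
  have : 1 ≤ (|u x| - a) / h := by rw [le_div_iff₀ hh]; linarith
  rw [levelSlice, min_eq_left this, max_eq_right zero_le_one]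

theorem levelSlice_eq_div {E : Type*} {u : E → ℝ} {a h : ℝ} (hh : 0 < h) {x : E}
    (hx : a < |u x|) (hx' : |u x| < a + h) : levelSlice u a h x = (|u x| - a) / h := by
  have h1 : (|u x| - a) / h ≤ 1 := by rw [div_le_iff₀ hh]; linarith
  have h2 : 0 ≤ (|u x| - a) / h := div_nonneg (by linarith) hh.le
  rw [levelSlice, min_eq_right h1, max_eq_right h2]

theorem LipschitzWith.levelSlice {E : Type*} [PseudoMetricSpace E] {K : ℝ≥0} {u : E → ℝ}
    (hu : LipschitzWith K u) (a : ℝ) {h : ℝ} (hh : 0 < h) :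
    LipschitzWith (K / h.toNNReal) (levelSlice u a h) := by
  have h1 : LipschitzWith (K / h.toNNReal) fun x => (|u x| - a) / h := by
    refine LipschitzWith.of_dist_le_mul fun x y => ?_
    rw [Real.dist_eq, ← sub_div, abs_div, abs_of_pos hh, NNReal.coe_div,
      Real.coe_toNNReal _ hh.le, div_mul_eq_mul_div]
    gcongr
    rw [sub_sub_sub_cancel_right]
    exact (abs_abs_sub_abs_le _ _).trans (hu.dist_le_mul x y)
  exact (h1.const_min 1).const_max 0

variable {E : Type*} [NormedAddCommGroup E] [NormedSpace ℝ E]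

/-- The bound holds at every point, with no exceptional null set: off the open slice the truncation
attains its global minimum `0` or maximum `1`, where `fderiv` is zero even without
differentiability; on the slice it is locally affine in `u`. -/
theorem enorm_fderiv_levelSlice_le {u : E → ℝ} (hu : Continuous u) {a h : ℝ} (ha : 0 ≤ a)
    (hh : 0 < h) (x : E) :
    ENNReal.ofReal h * ‖fderiv ℝ (levelSlice u a h) x‖ₑ ≤
      {x | a < |u x| ∧ |u x| < a + h}.indicator (fun x => ‖fderiv ℝ u x‖ₑ) x := by
  have hout : ∀ c, (fderiv ℝ (levelSlice u a h) x = 0) →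
      ENNReal.ofReal h * ‖fderiv ℝ (levelSlice u a h) x‖ₑ ≤ c := by
    intro c hc
    rw [hc, ← ofReal_norm, norm_zero]
    simp
  by_cases h1 : a < |u x|
  swap
  · refine hout _ (IsLocalMin.fderiv_eq_zero (Filter.Eventually.of_forall fun y => ?_))
    rw [levelSlice_eq_zero hh (not_lt.1 h1)]
    exact levelSlice_nonneg _ _ _ _
  by_cases h2 : |u x| < a + h
  swap
  · refine hout _ (IsLocalMax.fderiv_eq_zero (Filter.Eventually.of_forall fun y => ?_))
    rw [levelSlice_eq_one hh (not_lt.1 h2)]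
    exact levelSlice_le_one _ _ _ _
  rw [Set.indicator_of_mem (show x ∈ {x | a < |u x| ∧ |u x| < a + h} from ⟨h1, h2⟩)]
  -- Here `σ` is the sign of `u x`, locally constant near `x`.
  have key : ∀ σ : ℝ, |σ| = 1 → 0 < σ * u x →
      ENNReal.ofReal h * ‖fderiv ℝ (levelSlice u a h) x‖ₑ ≤ ‖fderiv ℝ u x‖ₑ := by
    intro σ hσ hpos
    have hev : levelSlice u a h =ᶠ[nhds x] fun y => (σ / h) * u y - a / h := by
      have e1 : ∀ᶠ y in nhds x, a < |u y| := hu.abs.continuousAt.eventually_const_lt h1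
      have e2 : ∀ᶠ y in nhds x, |u y| < a + h := hu.abs.continuousAt.eventually_lt_const h2
      have e3 : ∀ᶠ y in nhds x, 0 < σ * u y :=
        (continuous_const.mul hu).continuousAt.eventually_const_lt hpos
      filter_upwards [e1, e2, e3] with y h1 h2 h3
      have : |u y| = σ * u y := by rw [← abs_of_pos h3, abs_mul, hσ, one_mul]
      rw [levelSlice_eq_div hh h1 h2, this]
      ring
    rw [hev.fderiv_eq, fderiv_sub_const]
    have : (fun y => σ / h * u y) = (σ / h) • u := rfl
    rw [this, fderiv_const_smul_field, Pi.smul_apply, enorm_smul]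
    have hc : ENNReal.ofReal h * ‖σ / h‖ₑ = 1 := by
      rw [← ofReal_norm, ← ENNReal.ofReal_mul hh.le, Real.norm_eq_abs, abs_div, hσ,
        abs_of_pos hh, mul_one_div_cancel hh.ne', ENNReal.ofReal_one]
    rw [← mul_assoc, hc, one_mul]
  have hne : u x ≠ 0 := by
    intro h0; rw [h0, abs_zero] at h1; linarith
  rcases hne.lt_or_gt with hn | hp
  · exact key (-1) (by simp) (by linarith)
  · exact key 1 (by simp) (by linarith)

variable [FiniteDimensional ℝ E] [MeasurableSpace E] [BorelSpace E]
  (ν : Measure E) [ν.IsAddHaarMeasure]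

/-- A relative isoperimetric inequality in a ball for a pair of level sets of `|u|`. -/
theorem measure_le_mul_measure_le_of_levels {K : ℝ≥0} {u : E → ℝ} (hu : LipschitzWith K u) {a h : ℝ}
    (ha : 0 ≤ a) (hh : 0 < h) (x : E) (r : ℝ) :
    ENNReal.ofReal h * (ν (Metric.ball x r ∩ {x | |u x| ≤ a}) *
        ν (Metric.ball x r ∩ {x | a + h ≤ |u x|})) ≤
      2 ^ Module.finrank ℝ E * ENNReal.ofReal (2 * r) * ν (Metric.ball x r) *
        ∫⁻ z in Metric.ball x r ∩ {x | a < |u x| ∧ |u x| < a + h}, ‖fderiv ℝ u z‖ₑ ∂ν := by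
  set B := Metric.ball x r with hBdef
  have hBm : MeasurableSet B := measurableSet_ball
  have hm0 : MeasurableSet {x | |u x| ≤ a} :=
    (isClosed_le hu.continuous.abs continuous_const).measurableSet
  have hm1 : MeasurableSet {x | a + h ≤ |u x|} :=
    (isClosed_le continuous_const hu.continuous.abs).measurableSet
  have hmU : MeasurableSet {x | a < |u x| ∧ |u x| < a + h} :=
    ((isOpen_lt continuous_const hu.continuous.abs).inter
      (isOpen_lt hu.continuous.abs continuous_const)).measurableSet
  have hlow : ν (B ∩ {x | |u x| ≤ a}) * ν (B ∩ {x | a + h ≤ |u x|}) ≤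
      ∫⁻ y in B, ∫⁻ z in B, ‖levelSlice u a h z - levelSlice u a h y‖ₑ ∂ν ∂ν := by
    calc ν (B ∩ {x | |u x| ≤ a}) * ν (B ∩ {x | a + h ≤ |u x|})
        = ∫⁻ y in B ∩ {x | |u x| ≤ a}, ∫⁻ z in B ∩ {x | a + h ≤ |u x|}, 1 ∂ν ∂ν := by
          simp [mul_comm]
      _ ≤ ∫⁻ y in B ∩ {x | |u x| ≤ a}, ∫⁻ z in B ∩ {x | a + h ≤ |u x|},
            ‖levelSlice u a h z - levelSlice u a h y‖ₑ ∂ν ∂ν := by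
          refine setLIntegral_mono' (hBm.inter hm0) fun y hy =>
            setLIntegral_mono' (hBm.inter hm1) fun z hz => ?_
          rw [levelSlice_eq_zero hh hy.2, levelSlice_eq_one hh hz.2]
          simp
      _ ≤ _ := (lintegral_mono fun y => lintegral_mono_set Set.inter_subset_left).trans
          (lintegral_mono_set Set.inter_subset_left)
  have hP := (hu.levelSlice a hh).lintegral_lintegral_enorm_sub_le ν x (r := r)
  calc _ ≤ ENNReal.ofReal h * (2 ^ Module.finrank ℝ E * ENNReal.ofReal (2 * r) * ν B *
        ∫⁻ z in B, ‖fderiv ℝ (levelSlice u a h) z‖ₑ ∂ν) := mul_le_mul' le_rfl (hlow.trans hP)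
    _ = 2 ^ Module.finrank ℝ E * ENNReal.ofReal (2 * r) * ν B *
        ∫⁻ z in B, ENNReal.ofReal h * ‖fderiv ℝ (levelSlice u a h) z‖ₑ ∂ν := by
        rw [lintegral_const_mul' _ _ ENNReal.ofReal_ne_top]; ring
    _ ≤ 2 ^ Module.finrank ℝ E * ENNReal.ofReal (2 * r) * ν B *
        ∫⁻ z in B, {x | a < |u x| ∧ |u x| < a + h}.indicator (fun x => ‖fderiv ℝ u x‖ₑ) z ∂ν :=
        mul_le_mul' le_rfl
          (lintegral_mono fun z => enorm_fderiv_levelSlice_le hu.continuous ha hh z)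
    _ = _ := by rw [setLIntegral_indicator hmU, Set.inter_comm]

end Slice

/-! ### Vitali covering against the fractional maximal function. -/

section Boxing

variable {n : ℕ}

theorem EuclideanSpace.volume_ball_mul (x y : EuclideanSpace ℝ (Fin n)) {c : ℝ} (hc : 0 < c)
    (r : ℝ) :
    volume (Metric.ball x (c * r)) = ENNReal.ofReal c ^ n * volume (Metric.ball y r) := by
  rw [Measure.addHaar_ball_mul_of_pos _ _ hc, Measure.addHaar_ball_center volume y,
    finrank_euclideanSpace_fin, ENNReal.ofReal_pow hc.le]

/-- The ball of radius `7 r` about `y` contains that of radius `6 r` about `x`, so it is a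
competitor in the supremum at `y`. -/
theorem ofReal_mul_measure_ball_le_fractionalMaximal (μ : Measure (EuclideanSpace ℝ (Fin n)))
    {x y : EuclideanSpace ℝ (Fin n)} {r : ℝ} (hy : y ∈ Metric.ball x r) :
    ENNReal.ofReal r * μ (Metric.ball x (6 * r)) ≤
      7 ^ n * volume (Metric.ball x r) * fractionalMaximal 1 μ y := by
  have hr : 0 < r := Metric.pos_of_mem_ball hy
  have h7 : 0 < 7 * r := by positivity
  have hM : ENNReal.ofReal (7 * r) *
      (μ (Metric.ball y (7 * r)) / volume (Metric.ball y (7 * r))) ≤ fractionalMaximal 1 μ y := by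
    have : ENNReal.ofReal ((7 * r) ^ (1 : ℝ)) *
        (μ (Metric.ball y (7 * r)) / volume (Metric.ball y (7 * r))) ≤ fractionalMaximal 1 μ y :=
      le_iSup₂ (f := fun (r : ℝ) (_ : 0 < r) =>
        ENNReal.ofReal (r ^ (1 : ℝ)) * (μ (Metric.ball y r) / volume (Metric.ball y r))) (7 * r) h7
    rwa [Real.rpow_one] at this
  have hv0 : volume (Metric.ball y (7 * r)) ≠ 0 := (Metric.measure_ball_pos _ _ h7).ne'
  have hvt : volume (Metric.ball y (7 * r)) ≠ ∞ := measure_ball_lt_top.ne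
  rw [← mul_div_assoc, ENNReal.div_le_iff hv0 hvt] at hM
  have hsub : Metric.ball x (6 * r) ⊆ Metric.ball y (7 * r) :=
    Metric.ball_subset_ball' (by linarith [Metric.mem_ball'.1 hy])
  calc ENNReal.ofReal r * μ (Metric.ball x (6 * r))
      ≤ ENNReal.ofReal (7 * r) * μ (Metric.ball y (7 * r)) := by
        gcongr
        linarith
    _ ≤ _ := hM
    _ = _ := by
        rw [EuclideanSpace.volume_ball_mul y x (by norm_num : (0 : ℝ) < 7)]
        simp
        ring

/-- If every point of `G` is the centre of a ball on which the integral of `g` over `U` is large,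
then `μ G` is controlled by the integral over `U` of `g` against the maximal function of `μ`. -/
theorem mul_measure_le_lintegral_mul_fractionalMaximal (μ : Measure (EuclideanSpace ℝ (Fin n)))
    {g : EuclideanSpace ℝ (Fin n) → ℝ≥0∞} (hg : Measurable g)
    {U G : Set (EuclideanSpace ℝ (Fin n))} (hU : MeasurableSet U) {C H : ℝ≥0∞} {R : ℝ}
    (hG : ∀ x ∈ G, ∃ r, 0 < r ∧ r ≤ R ∧
      H * volume (Metric.ball x r) ≤ C * ENNReal.ofReal r * ∫⁻ z in Metric.ball x r ∩ U, g z) :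
    H * μ G ≤ C * 7 ^ n * ∫⁻ z in U, g z * fractionalMaximal 1 μ z := by
  choose! ρ hρ0 hρR hρ using hG
  -- Closed balls enlarged 5 times cover `G`; the factor 6 used below makes the covering balls open.
  obtain ⟨T, hTG, hdisj, hcov⟩ := Vitali.exists_disjoint_subfamily_covering_enlargement_closedBall
    G id ρ R hρR 5 (by norm_num)
  have hdisj' : T.PairwiseDisjoint fun x => Metric.ball x (ρ x) :=
    fun x hx y hy hxy => (hdisj hx hy hxy).mono Metric.ball_subset_closedBall
      Metric.ball_subset_closedBall
  have hTc : T.Countable := hdisj'.countable_of_isOpen (fun _ _ => Metric.isOpen_ball)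
    fun x hx => Metric.nonempty_ball.2 (hρ0 x (hTG hx))
  have hcover : G ⊆ ⋃ x ∈ T, Metric.ball x (6 * ρ x) := by
    intro x hx
    obtain ⟨b, hb, hsub⟩ := hcov x hx
    refine Set.mem_biUnion hb ?_
    refine Metric.closedBall_subset_ball ?_ (hsub (Metric.mem_closedBall_self (hρ0 x hx).le))
    linarith [hρ0 b (hTG hb)]
  have hone : ∀ x ∈ T, H * μ (Metric.ball x (6 * ρ x)) ≤
      C * 7 ^ n * ∫⁻ z in Metric.ball x (ρ x) ∩ U, g z * fractionalMaximal 1 μ z := by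
    intro x hx
    have hpos := hρ0 x (hTG hx)
    have hv0 : volume (Metric.ball x (ρ x)) ≠ 0 := (Metric.measure_ball_pos _ _ hpos).ne'
    have hvt : volume (Metric.ball x (ρ x)) ≠ ∞ := measure_ball_lt_top.ne
    rw [← ENNReal.mul_le_mul_iff_right hv0 hvt]
    calc volume (Metric.ball x (ρ x)) * (H * μ (Metric.ball x (6 * ρ x)))
        = H * volume (Metric.ball x (ρ x)) * μ (Metric.ball x (6 * ρ x)) := by ring
      _ ≤ C * ENNReal.ofReal (ρ x) * (∫⁻ z in Metric.ball x (ρ x) ∩ U, g z) *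
            μ (Metric.ball x (6 * ρ x)) := mul_le_mul' (hρ x (hTG hx)) le_rfl
      _ = C * ∫⁻ z in Metric.ball x (ρ x) ∩ U,
            g z * (ENNReal.ofReal (ρ x) * μ (Metric.ball x (6 * ρ x))) := by
          rw [lintegral_mul_const _ hg]; ring
      _ ≤ C * ∫⁻ z in Metric.ball x (ρ x) ∩ U,
            7 ^ n * volume (Metric.ball x (ρ x)) * (g z * fractionalMaximal 1 μ z) := by
          refine mul_le_mul' le_rfl (setLIntegral_mono' (measurableSet_ball.inter hU) ?_)
          intro z hz
          calc _ ≤ g z * (7 ^ n * volume (Metric.ball x (ρ x)) * fractionalMaximal 1 μ z) :=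
                mul_le_mul' le_rfl (ofReal_mul_measure_ball_le_fractionalMaximal μ hz.1)
            _ = _ := by ring
      _ = _ := by
          -- Finiteness of the constant replaces measurability of the maximal function.
          rw [lintegral_const_mul' _ _ (ENNReal.mul_ne_top (by simp) hvt)]
          ring
  calc H * μ G ≤ H * ∑' x : T, μ (Metric.ball (x : EuclideanSpace ℝ (Fin n)) (6 * ρ x)) :=
        mul_le_mul' le_rfl ((measure_mono hcover).trans (measure_biUnion_le μ hTc _))
    _ = ∑' x : T, H * μ (Metric.ball (x : EuclideanSpace ℝ (Fin n)) (6 * ρ x)) :=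
        ENNReal.tsum_mul_left.symm
    _ ≤ ∑' x : T, C * 7 ^ n * ∫⁻ z in Metric.ball (x : EuclideanSpace ℝ (Fin n)) (ρ x) ∩ U,
          g z * fractionalMaximal 1 μ z := ENNReal.tsum_le_tsum fun x => hone x x.2
    _ = C * 7 ^ n * ∫⁻ z in ⋃ x ∈ T, Metric.ball x (ρ x) ∩ U, g z * fractionalMaximal 1 μ z := by
        rw [ENNReal.tsum_mul_left, lintegral_biUnion hTc
          (fun x _ => measurableSet_ball.inter hU)
          (fun x hx y hy hxy => (hdisj' hx hy hxy).mono Set.inter_subset_left Set.inter_subset_left)]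
    _ ≤ _ := mul_le_mul' le_rfl
        (lintegral_mono_set (Set.iUnion₂_subset fun x _ => Set.inter_subset_right))

end Boxing

/-! ### Choice of scale, and counting of crowded points. -/

section Stopping

variable {n : ℕ}

/-- Among the balls of radius `R / 2 ^ k`, one meets both `{|u| ≤ a}` and `{a < |u|}` in a definite
proportion of its volume. -/
theorem LipschitzWith.exists_ball_balanced {K : ℝ≥0} {u : EuclideanSpace ℝ (Fin n) → ℝ}
    (hu : LipschitzWith K u) {a h R : ℝ} (hR : 0 < R) {N : ℕ} (hN : K * (R / 2 ^ N) < h)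
    {x : EuclideanSpace ℝ (Fin n)} (hx : a + h ≤ |u x|)
    (hvol : 2 * volume {y | a < |u y|} ≤ volume (Metric.ball x R)) :
    ∃ k < N, volume (Metric.ball x (R / 2 ^ k)) ≤
        2 * volume (Metric.ball x (R / 2 ^ k) ∩ {y | |u y| ≤ a}) ∧
      volume (Metric.ball x (R / 2 ^ k)) ≤
        2 ^ (n + 1) * volume (Metric.ball x (R / 2 ^ k) ∩ {y | a < |u y|}) := by
  classical
  have hex : ∃ k : ℕ, volume (Metric.ball x (R / 2 ^ k)) <
      2 * volume (Metric.ball x (R / 2 ^ k) ∩ {y | a < |u y|}) ∧ k ≤ N := by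
    refine ⟨N, ?_, le_rfl⟩
    have hsub : Metric.ball x (R / 2 ^ N) ⊆ {y | a < |u y|} := by
      intro y hy
      have h1 : |u x| - |u y| ≤ K * dist x y :=
        (abs_sub_abs_le_abs_sub _ _).trans (hu.dist_le_mul x y)
      have h2 : (K : ℝ) * dist x y ≤ K * (R / 2 ^ N) := by
        gcongr
        exact (Metric.mem_ball'.1 hy).le
      show a < |u y|
      linarith
    rw [Set.inter_eq_left.2 hsub, two_mul]
    exact ENNReal.lt_add_right measure_ball_lt_top.ne
      (Metric.measure_ball_pos _ _ (by positivity)).ne'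
  have hspec := (Nat.find_spec hex).1
  have hle := (Nat.find_spec hex).2
  have hmin := fun {m} => Nat.find_min hex (m := m)
  set k₀ := Nat.find hex
  have hk0 : k₀ ≠ 0 := by
    intro h0
    rw [h0] at hspec
    simp only [pow_zero, div_one] at hspec
    refine absurd (hspec.trans_le ?_) (lt_irrefl _)
    exact (mul_le_mul' le_rfl (measure_mono Set.inter_subset_right)).trans hvol
  -- The balanced ball is the last one before `{a < |u|}` exceeds half the volume. Minimality bounds
  -- `{a < |u|}` above there; the next smaller ball bounds it below, at the cost of a factor `2 ^
  -- n`.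
  obtain ⟨k, hk⟩ := Nat.exists_eq_succ_of_ne_zero hk0
  rw [hk] at hspec hle hmin
  have hkN : k < N := hle
  have hnot : 2 * volume (Metric.ball x (R / 2 ^ k) ∩ {y | a < |u y|}) ≤
      volume (Metric.ball x (R / 2 ^ k)) := by
    by_contra hcon
    exact hmin (Nat.lt_succ_self k) ⟨not_le.1 hcon, hkN.le⟩
  have hm : MeasurableSet {y | a < |u y|} :=
    (isOpen_lt continuous_const hu.continuous.abs).measurableSet
  refine ⟨k, hkN, ?_, ?_⟩
  · have hsplit := measure_inter_add_sdiff (μ := volume) (Metric.ball x (R / 2 ^ k)) hm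
    have hdiff : Metric.ball x (R / 2 ^ k) \ {y | a < |u y|} =
        Metric.ball x (R / 2 ^ k) ∩ {y | |u y| ≤ a} := by
      ext y; simp
    rw [hdiff] at hsplit
    have hfin : volume (Metric.ball x (R / 2 ^ k)) ≠ ∞ := measure_ball_lt_top.ne
    refine (ENNReal.add_le_add_iff_left hfin).1 ?_
    calc volume (Metric.ball x (R / 2 ^ k)) + volume (Metric.ball x (R / 2 ^ k))
        = 2 * volume (Metric.ball x (R / 2 ^ k) ∩ {y | a < |u y|}) +
          2 * volume (Metric.ball x (R / 2 ^ k) ∩ {y | |u y| ≤ a}) := by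
          rw [← mul_add, hsplit, two_mul]
      _ ≤ _ := add_le_add hnot le_rfl
  · calc volume (Metric.ball x (R / 2 ^ k))
        = 2 ^ n * volume (Metric.ball x (R / 2 ^ (k + 1))) := by
          rw [show R / 2 ^ k = 2 * (R / 2 ^ (k + 1)) by rw [pow_succ]; field_simp,
            EuclideanSpace.volume_ball_mul x x two_pos]
          simp
      _ ≤ 2 ^ n * (2 * volume (Metric.ball x (R / 2 ^ k) ∩ {y | a < |u y|})) := by
          refine mul_le_mul' le_rfl (hspec.le.trans (mul_le_mul' le_rfl (measure_mono ?_)))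
          refine Set.inter_subset_inter_left _ (Metric.ball_subset_ball ?_)
          refine div_le_div_of_nonneg_left hR.le (by positivity) ?_
          exact pow_le_pow_right₀ one_le_two (Nat.le_succ k)
      _ = _ := by ring

/-- A ball in which `{|u| ≤ a}` and `{a < |u|}` are balanced and the slice `{a < |u| < a + h}` is
thin carries a definite part of the integral of the derivative over the slice. -/
theorem LipschitzWith.ofReal_mul_volume_ball_le {K : ℝ≥0} {u : EuclideanSpace ℝ (Fin n) → ℝ}
    (hu : LipschitzWith K u) {a h : ℝ} (ha : 0 ≤ a) (hh : 0 < h)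
    {x : EuclideanSpace ℝ (Fin n)} {r : ℝ} (hr : 0 < r)
    (hlow : volume (Metric.ball x r) ≤ 2 * volume (Metric.ball x r ∩ {y | |u y| ≤ a}))
    (hupp : volume (Metric.ball x r) ≤ 2 ^ (n + 1) * volume (Metric.ball x r ∩ {y | a < |u y|}))
    (hthin : 2 ^ (n + 2) * volume (Metric.ball x r ∩ {y | a < |u y| ∧ |u y| < a + h}) ≤
      volume (Metric.ball x r)) :
    ENNReal.ofReal h * volume (Metric.ball x r) ≤ 2 ^ (2 * n + 4) * ENNReal.ofReal r *
      ∫⁻ z in Metric.ball x r ∩ {y | a < |u y| ∧ |u y| < a + h}, ‖fderiv ℝ u z‖ₑ := by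
  have hiso := measure_le_mul_measure_le_of_levels volume hu ha hh x r
  set B := Metric.ball x r
  have hB0 : volume B ≠ 0 := (Metric.measure_ball_pos _ _ hr).ne'
  have hBt : volume B ≠ ∞ := measure_ball_lt_top.ne
  have hF : volume B ≤ 2 ^ (n + 2) * volume (B ∩ {y | a + h ≤ |u y|}) := by
    -- Doubling `hupp` leaves one copy of the volume of `B` to absorb the thin slice.
    refine (ENNReal.add_le_add_iff_left hBt).1 ?_
    calc volume B + volume B ≤ 2 * (2 ^ (n + 1) * volume (B ∩ {y | a < |u y|})) := by
          rw [← two_mul]; exact mul_le_mul' le_rfl hupp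
      _ = 2 ^ (n + 2) * volume (B ∩ {y | a < |u y|}) := by ring
      _ ≤ 2 ^ (n + 2) * (volume (B ∩ {y | a < |u y| ∧ |u y| < a + h}) +
            volume (B ∩ {y | a + h ≤ |u y|})) := by
          refine mul_le_mul' le_rfl ((measure_mono ?_).trans (measure_union_le _ _))
          rintro y ⟨hyB, hya⟩
          rcases lt_or_ge (|u y|) (a + h) with hlt | hge
          · exact Or.inl ⟨hyB, hya, hlt⟩
          · exact Or.inr ⟨hyB, hge⟩
      _ ≤ _ := by rw [mul_add]; exact add_le_add hthin le_rfl
  rw [finrank_euclideanSpace_fin] at hiso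
  rw [← ENNReal.mul_le_mul_iff_right hB0 hBt]
  calc volume B * (ENNReal.ofReal h * volume B)
      = ENNReal.ofReal h * (volume B * volume B) := by ring
    _ ≤ ENNReal.ofReal h * ((2 * volume (B ∩ {y | |u y| ≤ a})) *
          (2 ^ (n + 2) * volume (B ∩ {y | a + h ≤ |u y|}))) := by gcongr
    _ = 2 ^ (n + 3) * (ENNReal.ofReal h * (volume (B ∩ {y | |u y| ≤ a}) *
          volume (B ∩ {y | a + h ≤ |u y|}))) := by ring
    _ ≤ 2 ^ (n + 3) * _ := mul_le_mul' le_rfl hiso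
    _ = _ := by
        rw [ENNReal.ofReal_mul zero_le_two, ENNReal.ofReal_ofNat]
        ring

/-- The points `x` such that, at some scale `R / 2 ^ k` with `k < N`, the set `U` occupies more than
the proportion `2 ^ (-(n + 2))` of the ball centred at `x`. -/
def crowdedPoints (U : Set (EuclideanSpace ℝ (Fin n))) (R : ℝ) (N : ℕ) :
    Set (EuclideanSpace ℝ (Fin n)) :=
  {x | ∃ k < N, volume (Metric.ball x (R / 2 ^ k)) <
    2 ^ (n + 2) * volume (Metric.ball x (R / 2 ^ k) ∩ U)}

theorem LipschitzWith.ofReal_mul_measure_sdiff_crowdedPoints_le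
    (μ : Measure (EuclideanSpace ℝ (Fin n))) {K : ℝ≥0} {u : EuclideanSpace ℝ (Fin n) → ℝ}
    (hu : LipschitzWith K u) {a h R : ℝ} (ha : 0 ≤ a) (hh : 0 < h) (hR : 0 < R) {N : ℕ}
    (hN : K * (R / 2 ^ N) < h)
    (hvol : ∀ x : EuclideanSpace ℝ (Fin n), 2 * volume {y | a < |u y|} ≤ volume (Metric.ball x R)) :
    ENNReal.ofReal h *
        μ ({x | a + h ≤ |u x|} \ crowdedPoints {y | a < |u y| ∧ |u y| < a + h} R N) ≤
      2 ^ (2 * n + 4) * 7 ^ n * ∫⁻ z in {y | a < |u y| ∧ |u y| < a + h},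
        ‖fderiv ℝ u z‖ₑ * fractionalMaximal 1 μ z := by
  have hmU : MeasurableSet {x | a < |u x| ∧ |u x| < a + h} :=
    ((isOpen_lt continuous_const hu.continuous.abs).inter
      (isOpen_lt hu.continuous.abs continuous_const)).measurableSet
  refine mul_measure_le_lintegral_mul_fractionalMaximal μ (measurable_fderiv ℝ u).enorm hmU
    (R := R) ?_
  rintro x ⟨hxF, hxB⟩
  obtain ⟨k, hkN, hlow, hupp⟩ := hu.exists_ball_balanced hR hN hxF (hvol x)
  have hthin : 2 ^ (n + 2) * volume (Metric.ball x (R / 2 ^ k) ∩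
      {y | a < |u y| ∧ |u y| < a + h}) ≤ volume (Metric.ball x (R / 2 ^ k)) := by
    by_contra hcon
    exact hxB ⟨k, hkN, not_le.1 hcon⟩
  exact ⟨R / 2 ^ k, by positivity, div_le_self hR.le (one_le_pow₀ one_le_two),
    hu.ofReal_mul_volume_ball_le ha hh (by positivity) hlow hupp hthin⟩

theorem measurable_volume_ball_inter {U : Set (EuclideanSpace ℝ (Fin n))} (hU : MeasurableSet U)
    (r : ℝ) : Measurable fun x => volume (Metric.ball x r ∩ U) := by
  have hs : MeasurableSet {p : EuclideanSpace ℝ (Fin n) × EuclideanSpace ℝ (Fin n) |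
      dist p.2 p.1 < r ∧ p.2 ∈ U} :=
    (isOpen_lt (continuous_snd.dist continuous_fst) continuous_const).measurableSet.inter
      (measurable_snd hU)
  exact measurable_measure_prodMk_left (ν := volume) hs

/-- Disjoint sets cannot all be crowded at the same place and scale. -/
theorem tsum_measure_inter_crowdedPoints_le (μ : Measure (EuclideanSpace ℝ (Fin n)))
    {U : ℕ → Set (EuclideanSpace ℝ (Fin n))} (hU : ∀ i, MeasurableSet (U i))
    (hd : Pairwise (Function.onFun Disjoint U)) {R : ℝ} (hR : 0 < R) (N : ℕ)
    (S : Set (EuclideanSpace ℝ (Fin n))) (hS : MeasurableSet S) :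
    ∑' i, μ (S ∩ crowdedPoints (U i) R N) ≤ N * (2 ^ (n + 2) * μ S) := by
  set D : ℕ → ℕ → Set (EuclideanSpace ℝ (Fin n)) := fun k i =>
    {x | volume (Metric.ball x (R / 2 ^ k)) ≤
      2 ^ (n + 2) * volume (Metric.ball x (R / 2 ^ k) ∩ U i)} with hD
  have hscale : ∀ k, ∑' i, μ (S ∩ D k i) ≤ 2 ^ (n + 2) * μ S := by
    intro k
    set r := R / 2 ^ k with hr
    have hr0 : 0 < r := by positivity
    set c := volume (Metric.ball (0 : EuclideanSpace ℝ (Fin n)) r) with hc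
    have hc0 : c ≠ 0 := (Metric.measure_ball_pos _ _ hr0).ne'
    have hct : c ≠ ∞ := measure_ball_lt_top.ne
    have hcx : ∀ x : EuclideanSpace ℝ (Fin n), volume (Metric.ball x r) = c := fun x =>
      Measure.addHaar_ball_center _ _ _
    rw [← ENNReal.mul_le_mul_iff_right hc0 hct, ← ENNReal.tsum_mul_left]
    have hmeas : ∀ i, Measurable fun x => 2 ^ (n + 2) * volume (Metric.ball x r ∩ U i) := fun i =>
      (measurable_volume_ball_inter (hU i) r).const_mul _
    calc ∑' i, c * μ (S ∩ D k i)
        ≤ ∑' i, ∫⁻ x in S, 2 ^ (n + 2) * volume (Metric.ball x r ∩ U i) ∂μ := by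
          refine ENNReal.tsum_le_tsum fun i => ?_
          -- Markov's inequality, with the same threshold `c` for every centre because Lebesgue
          -- measure is translation invariant.
          have hmk := mul_meas_ge_le_lintegral (μ := μ.restrict S) (hmeas i) c
          rw [Measure.restrict_apply' hS, Set.inter_comm] at hmk
          simpa only [hD, ← hr, hcx] using hmk
      _ = ∫⁻ x in S, ∑' i, 2 ^ (n + 2) * volume (Metric.ball x r ∩ U i) ∂μ :=
          (lintegral_tsum fun i => (hmeas i).aemeasurable).symm
      _ ≤ ∫⁻ x in S, 2 ^ (n + 2) * c ∂μ := by
          refine lintegral_mono fun x => ?_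
          rw [ENNReal.tsum_mul_left, ← measure_iUnion
            (fun i j hij => (hd hij).mono Set.inter_subset_right Set.inter_subset_right)
            (fun i => measurableSet_ball.inter (hU i)), ← hcx x]
          exact mul_le_mul' le_rfl (measure_mono (Set.iUnion_subset fun i => Set.inter_subset_left))
      _ = _ := by rw [setLIntegral_const]; ring
  calc ∑' i, μ (S ∩ crowdedPoints (U i) R N)
      ≤ ∑' i, ∑ k ∈ Finset.range N, μ (S ∩ D k i) := by
        refine ENNReal.tsum_le_tsum fun i => ?_
        refine (measure_mono ?_).trans (measure_biUnion_finset_le _ _)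
        rintro x ⟨hxS, k, hk, hx⟩
        simp only [Set.mem_iUnion, Finset.mem_range]
        exact ⟨k, hk, hxS, hx.le⟩
    _ = ∑ k ∈ Finset.range N, ∑' i, μ (S ∩ D k i) :=
        Summable.tsum_finsetSum fun _ _ => ENNReal.summable
    _ ≤ ∑ k ∈ Finset.range N, 2 ^ (n + 2) * μ S := Finset.sum_le_sum fun k _ => hscale k
    _ = _ := by simp

end Stopping

/-! ### Discrete layer cake. -/

section LayerSum

/-- A discrete layer-cake bound. -/
theorem lintegral_enorm_le_tsum_levels {α : Type*} [MeasurableSpace α] (μ : Measure α) {u : α → ℝ}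
    (hu : Measurable u) {h : ℝ} (hh : 0 < h) :
    ∫⁻ x, ‖u x‖ₑ ∂μ ≤ ENNReal.ofReal h * μ (Function.support u) +
      ∑' i : ℕ, ENNReal.ofReal h * μ {x | i * h + h ≤ |u x|} := by
  have hm : ∀ i : ℕ, MeasurableSet {x | i * h + h ≤ |u x|} := fun i =>
    measurableSet_le measurable_const (by fun_prop)
  have hs : MeasurableSet (Function.support u) := measurableSet_support hu
  have hpt : ∀ x, ‖u x‖ₑ ≤ (Function.support u).indicator (fun _ => ENNReal.ofReal h) x +
      ∑' i : ℕ, {x | i * h + h ≤ |u x|}.indicator (fun _ => ENNReal.ofReal h) x := by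
    intro x
    by_cases hx : u x = 0
    · simp [hx]
    rw [Set.indicator_of_mem (show x ∈ Function.support u from hx)]
    set m := ⌊|u x| / h⌋₊ with hmdef
    have h1 : |u x| ≤ h + m * h := by
      have := (Nat.lt_floor_add_one (|u x| / h)).le
      rw [div_le_iff₀ hh] at this
      linarith
    have h2 : (m : ℝ) * h ≤ |u x| := by
      have := Nat.floor_le (div_nonneg (abs_nonneg (u x)) hh.le)
      rwa [le_div_iff₀ hh] at this
    calc ‖u x‖ₑ = ENNReal.ofReal |u x| := by rw [← ofReal_norm, Real.norm_eq_abs]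
      _ ≤ ENNReal.ofReal (h + m * h) := ENNReal.ofReal_le_ofReal h1
      _ = ENNReal.ofReal h + ∑ i ∈ Finset.range m, ENNReal.ofReal h := by
          rw [ENNReal.ofReal_add hh.le (by positivity), ENNReal.ofReal_mul (Nat.cast_nonneg m)]
          simp
      _ = ENNReal.ofReal h + ∑ i ∈ Finset.range m,
            {x | i * h + h ≤ |u x|}.indicator (fun _ => ENNReal.ofReal h) x := by
          congr 1
          refine Finset.sum_congr rfl fun i hi => ?_
          have hi' : (i : ℝ) + 1 ≤ m := by exact_mod_cast Finset.mem_range.1 hi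
          rw [Set.indicator_of_mem]
          show (i : ℝ) * h + h ≤ |u x|
          nlinarith
      _ ≤ _ := add_le_add le_rfl (ENNReal.sum_le_tsum _)
  refine (lintegral_mono hpt).trans ?_
  rw [lintegral_add_left (measurable_const.indicator hs), lintegral_indicator_const hs,
    lintegral_tsum fun i => (measurable_const.indicator (hm i)).aemeasurable]
  simp_rw [fun i => lintegral_indicator_const (μ := μ) (hm i) (ENNReal.ofReal h)]
  exact le_rfl

end LayerSum

/-! ### Summation over levels and the limit of vanishing spacing. -/

section Trace

variable {n : ℕ}

/-- The estimate at the level spacing `h`, with an error controlled by the number of scales. -/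
theorem LipschitzWith.lintegral_enorm_le_add_error
    (μ : Measure (EuclideanSpace ℝ (Fin n))) {K : ℝ≥0} {u : EuclideanSpace ℝ (Fin n) → ℝ}
    (hu : LipschitzWith K u) {h R : ℝ} (hh : 0 < h) (hR : 0 < R) {N : ℕ}
    (hN : K * (R / 2 ^ N) < h)
    (hvol : ∀ x : EuclideanSpace ℝ (Fin n),
      2 * volume (Function.support u) ≤ volume (Metric.ball x R)) :
    ∫⁻ x, ‖u x‖ₑ ∂μ ≤
      2 ^ (2 * n + 4) * 7 ^ n * (∫⁻ z, ‖fderiv ℝ u z‖ₑ * fractionalMaximal 1 μ z) +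
        ENNReal.ofReal (h * (1 + N * 2 ^ (n + 2))) * μ (Function.support u) := by
  set U : ℕ → Set (EuclideanSpace ℝ (Fin n)) := fun i =>
    {y | i * h < |u y| ∧ |u y| < i * h + h} with hUdef
  have hmU : ∀ i, MeasurableSet (U i) := fun i =>
    ((isOpen_lt continuous_const hu.continuous.abs).inter
      (isOpen_lt hu.continuous.abs continuous_const)).measurableSet
  have hlt : ∀ i j : ℕ, i < j → Disjoint (U i) (U j) := by
    intro i j hij
    refine Set.disjoint_left.2 fun y hi hj => ?_
    have hij' : (i : ℝ) + 1 ≤ j := by exact_mod_cast hij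
    have h1 := hi.2
    have h2 := hj.1
    nlinarith
  have hd : Pairwise (Function.onFun Disjoint U) := fun i j hij =>
    hij.lt_or_gt.elim (hlt i j) fun h => (hlt j i h).symm
  have hlevel : ∀ i : ℕ, ENNReal.ofReal h * μ {x | i * h + h ≤ |u x|} ≤
      2 ^ (2 * n + 4) * 7 ^ n * (∫⁻ z in U i, ‖fderiv ℝ u z‖ₑ * fractionalMaximal 1 μ z) +
        ENNReal.ofReal h * μ (Function.support u ∩ crowdedPoints (U i) R N) := by
    intro i
    have ha : (0 : ℝ) ≤ i * h := by positivity
    have hsupp : ∀ x, i * h < |u x| → x ∈ Function.support u := by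
      intro x hx h0
      rw [h0, abs_zero] at hx
      linarith
    have hgood := hu.ofReal_mul_measure_sdiff_crowdedPoints_le μ ha hh hR hN fun x =>
      (mul_le_mul' le_rfl (measure_mono hsupp)).trans (hvol x)
    refine le_trans ?_ (add_le_add hgood le_rfl)
    rw [← mul_add]
    refine mul_le_mul' le_rfl ((measure_mono ?_).trans (measure_union_le _ _))
    intro x hx
    by_cases hxB : x ∈ crowdedPoints (U i) R N
    · exact Or.inr ⟨hsupp x (by linarith [show (i : ℝ) * h + h ≤ |u x| from hx]), hxB⟩
    · exact Or.inl ⟨hx, hxB⟩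
  refine (lintegral_enorm_le_tsum_levels μ hu.continuous.measurable hh).trans ?_
  have hsm : MeasurableSet (Function.support u) := hu.continuous.isOpen_support.measurableSet
  calc _ ≤ ENNReal.ofReal h * μ (Function.support u) +
        (2 ^ (2 * n + 4) * 7 ^ n *
            (∑' i, ∫⁻ z in U i, ‖fderiv ℝ u z‖ₑ * fractionalMaximal 1 μ z) +
          ENNReal.ofReal h * ∑' i, μ (Function.support u ∩ crowdedPoints (U i) R N)) := by
        rw [← ENNReal.tsum_mul_left, ← ENNReal.tsum_mul_left, ← ENNReal.tsum_add]
        exact add_le_add le_rfl (ENNReal.tsum_le_tsum hlevel)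
    _ ≤ ENNReal.ofReal h * μ (Function.support u) +
        (2 ^ (2 * n + 4) * 7 ^ n * (∫⁻ z, ‖fderiv ℝ u z‖ₑ * fractionalMaximal 1 μ z) +
          ENNReal.ofReal h * (N * (2 ^ (n + 2) * μ (Function.support u)))) := by
        rw [← lintegral_iUnion hmU hd]
        gcongr
        · exact Measure.restrict_le_self
        · exact tsum_measure_inter_crowdedPoints_le μ hmU hd hR N _ hsm
    _ = _ := by
        have : ENNReal.ofReal (h * (1 + N * 2 ^ (n + 2))) =
            ENNReal.ofReal h * (1 + N * 2 ^ (n + 2)) := by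
          rw [ENNReal.ofReal_mul hh.le, ENNReal.ofReal_add zero_le_one (by positivity),
            ENNReal.ofReal_mul (Nat.cast_nonneg N), ENNReal.ofReal_pow zero_le_two]
          simp
        rw [this]
        ring

theorem LipschitzWith.lintegral_enorm_le_fractionalMaximal (hn : 1 ≤ n)
    (μ : Measure (EuclideanSpace ℝ (Fin n))) [IsLocallyFiniteMeasure μ] {K : ℝ≥0}
    {u : EuclideanSpace ℝ (Fin n) → ℝ} (hu : LipschitzWith K u) (hc : HasCompactSupport u) :
    ∫⁻ x, ‖u x‖ₑ ∂μ ≤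
      2 ^ (2 * n + 4) * 7 ^ n * ∫⁻ z, ‖fderiv ℝ u z‖ₑ * fractionalMaximal 1 μ z := by
  have hμ : μ (Function.support u) ≠ ∞ :=
    ((measure_mono (subset_tsupport u)).trans_lt hc.isCompact.measure_lt_top).ne
  obtain ⟨ρ, hρ0, hρ⟩ := hc.isCompact.isBounded.subset_ball_lt 0 0
  have hR : 0 < 2 * ρ := by positivity
  have hvol : ∀ x : EuclideanSpace ℝ (Fin n),
      2 * volume (Function.support u) ≤ volume (Metric.ball x (2 * ρ)) := by
    intro x
    rw [EuclideanSpace.volume_ball_mul x 0 two_pos]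
    refine mul_le_mul' ?_ (measure_mono ((subset_tsupport u).trans hρ))
    rw [ENNReal.ofReal_ofNat]
    -- The dimension enters here: `2 ≤ 2 ^ n` needs `n ≥ 1`.
    exact le_self_pow₀ one_le_two (by omega)
  obtain ⟨A, hA⟩ := pow_unbounded_of_one_lt (K * (2 * ρ)) (one_lt_two (α := ℝ))
  -- Spacing `h = 2⁻ᵐ` with `N = m + A` scales: the choice of `A` gives `K R / 2 ^ N < h`, and the
  -- error is of order `m 2⁻ᵐ`.
  have hbound : ∀ m : ℕ, ∫⁻ x, ‖u x‖ₑ ∂μ ≤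
      2 ^ (2 * n + 4) * 7 ^ n * (∫⁻ z, ‖fderiv ℝ u z‖ₑ * fractionalMaximal 1 μ z) +
        ENNReal.ofReal ((1 / 2) ^ m * (1 + (m + A : ℕ) * 2 ^ (n + 2))) *
          μ (Function.support u) := by
    intro m
    refine hu.lintegral_enorm_le_add_error μ (by positivity) hR ?_ hvol
    rw [← mul_div_assoc, div_lt_iff₀ (by positivity), pow_add,
      ← mul_assoc ((1 / 2 : ℝ) ^ m), ← mul_pow]
    simpa using hA
  have hreal : Filter.Tendsto (fun m : ℕ => ((1 / 2 : ℝ)) ^ m * (1 + (m + A : ℕ) * 2 ^ (n + 2)))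
      Filter.atTop (nhds 0) := by
    have h1 := tendsto_self_mul_const_pow_of_lt_one (r := (1 / 2 : ℝ)) (by norm_num) (by norm_num)
    have h2 := tendsto_pow_atTop_nhds_zero_of_lt_one (r := (1 / 2 : ℝ)) (by norm_num) (by norm_num)
    have h3 := (h1.mul_const ((2 : ℝ) ^ (n + 2))).add (h2.mul_const (1 + (A : ℝ) * 2 ^ (n + 2)))
    rw [zero_mul, zero_mul, add_zero] at h3
    refine h3.congr fun m => ?_
    push_cast
    ring
  have herr := ENNReal.Tendsto.mul_const (ENNReal.tendsto_ofReal hreal) (Or.inr hμ)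
  rw [ENNReal.ofReal_zero, zero_mul] at herr
  have hlim := (tendsto_const_nhds (x := 2 ^ (2 * n + 4) * 7 ^ n *
    ∫⁻ z, ‖fderiv ℝ u z‖ₑ * fractionalMaximal 1 μ z)).add herr
  rw [add_zero] at hlim
  exact ge_of_tendsto' hlim hbound

end Trace

theorem theorem2p1 (n : ℕ) (hn : 1 ≤ n) :
    ∃ C : ℝ≥0, ∀ μ : Measure (EuclideanSpace ℝ (Fin n)), IsLocallyFiniteMeasure μ →
      ∀ u : EuclideanSpace ℝ (Fin n) → ℝ, (∃ K : ℝ≥0, LipschitzWith K u) → HasCompactSupport u →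
        ∫⁻ x, ‖u x‖ₑ ∂μ ≤
          (C : ℝ≥0∞) * ∫⁻ x, ‖gradient u x‖ₑ * fractionalMaximal 1 μ x := by
  refine ⟨2 ^ (2 * n + 4) * 7 ^ n, fun μ hμ u ⟨K, hu⟩ hc => ?_⟩
  have hgrad : ∀ x, ‖gradient u x‖ₑ = ‖fderiv ℝ u x‖ₑ := fun x => by
    rw [← ofReal_norm, ← ofReal_norm, gradient, LinearIsometryEquiv.norm_map]
  simp_rw [hgrad]
  push_cast
  exact hu.lintegral_enorm_le_fractionalMaximal hn μ hc
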